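/- Let $k$ be an algebraically closed field and $R = k[x_0,x_1,y_0,y_1]$, bigraded by $\deg x_a = (1,0)$, $\deg y_a = (0,1)$, with $R_{i,j}$ the space of bihomogeneous polynomials of degree $(i,j)$. The ideal of a point $P = [a_0:a_1]\times[b_0:b_1]$ of $\mathbb{P}^1\times\mathbb{P}^1$ is $\wp_P = (a_1x_0-a_0x_1,\ b_1y_0-b_0y_1)$. Let $Z = \{(P;m_P) \mid P \in \mathbb{X}\}$ be a fat point scheme, that is, a finite set $\mathbb{X} \subset \mathbb{P}^1\times\mathbb{P}^1$ (the support) with a positive integer multiplicity $m_P$ for each $P \in \mathbb{X}$. Put $I_Z = \bigcap_{P\in\mathbb{X}} \wp_P^{m_P}$ and $H_Z(i,j) = \dim_k R_{i,j}/(I_Z \cap R_{i,j})$ for $i,j \in \mathbb{N} = \{0,1,2,\dots\}$. Let $R_1,\dots,R_r$ be the distinct first coordinates, and $Q_1,\dots,Q_t$ the distinct second coordinates, of the points of $\mathbb{X}$. Write $(n)_+ = \max\{n,0\}$. For $1 \le u \le r$ let $l_u$ be the maximum of $m_P$ over the $P\in\mathbb{X}$ with first coordinate $R_u$, and for $0 \le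 n \le l_u-1$ let $a_{u,n} = \sum_P (m_P-n)_+$, the sum over the same points. Let $\alpha_Z$ be the tuple of all the $a_{u,n}$, entries counted with repetition. Define $l'_v$, $b_{v,n}$ and $\beta_Z$ in the same way from the second coordinates $Q_v$, $1\le v\le t$. Then, for all $i,j\in\mathbb{N}$: 1. if $i \ge l_1+\cdots+l_r-1$, then $H_Z(i,j) = \sum_{h=1}^{j+1} \#\{\text{entries of } \alpha_Z \text{ that are} \ge h\}$; 2. if $j \ge l'_1+\cdots+l'_t-1$, then $H_Z(i,j) = \sum_{h=1}^{i+1} \#\{\text{entries of } \beta_Z \text{ that are} \ge h\}$; 3. consequently these values depend only on the multiplicities and on which points share a projection: if $Z'$ is another fat point scheme over $k$ and there is a bijection from the support of $Z$ to the support of $Z'$ that preserves multiplicities, and under which two points have the same first (respectively second) coordinate if and only if their images do, then $H_{Z'}(i,j) = H_Z(i,j)$ whenever $i \ge l_1+\cdots+l_r-1$ or $j \ge l'_1+\cdots+l'_t-1$. -/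

import Mathlib

open MvPolynomial
open scoped LinearAlgebra.Projectivization

noncomputable section

namespace FatPoints

/-- The projective line over `k`, as the set of lines through the origin in `k²`. -/
abbrev P1 (k : Type*) [Field k] : Type _ := ℙ k (Fin 2 → k)

/-- The coordinate ring `R = k[x₀, x₁, y₀, y₁]` of `ℙ¹ × ℙ¹`;
`X (Sum.inl a)` is `x_a` and `X (Sum.inr a)` is `y_a`. -/
abbrev CoordRing (k : Type*) [Field k] : Type _ := MvPolynomial (Fin 2 ⊕ Fin 2) k

/-- The bidegrees of the variables: `deg x_a = (1, 0)` and `deg y_a = (0, 1)`. -/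
def bidegree : Fin 2 ⊕ Fin 2 → ℕ × ℕ :=
  Sum.elim (fun _ => (1, 0)) (fun _ => (0, 1))

variable {k : Type*} [Field k]

/-- The space `R_{i,j}` of bihomogeneous polynomials of degree `(i, j)`. -/
def bihomogeneous (k : Type*) [Field k] (i j : ℕ) : Submodule k (CoordRing k) :=
  weightedHomogeneousSubmodule k bidegree (i, j)

/-- The spaces `R_{i,j}` are finite-dimensional, so that all dimensions here are genuine. -/
instance bihomogeneous_finite (i j : ℕ) : Module.Finite k (bihomogeneous k i j) := by
  have hle : bihomogeneous k i j ≤ restrictTotalDegree (Fin 2 ⊕ Fin 2) k (i + j) := by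
    intro p hp
    rw [mem_restrictTotalDegree]
    refine Finset.sup_le fun d hd => ?_
    have h := hp (mem_support_iff.mp hd)
    simp [Finsupp.weight_apply, Finsupp.sum_fintype, bidegree, Prod.ext_iff] at h
    simp [Finsupp.sum_fintype]
    omega
  have : Module.Finite k (restrictTotalDegree (Fin 2 ⊕ Fin 2) k (i + j)) := inferInstance
  exact Submodule.finiteDimensional_of_le hle

/-- The subspace `I_{i,j} = I ∩ R_{i,j}` of `R_{i,j}`. -/
def gradedPart (I : Ideal (CoordRing k)) (i j : ℕ) : Submodule k (bihomogeneous k i j) :=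
  (I.restrictScalars k).comap (bihomogeneous k i j).subtype

/-- The Hilbert function of `R / I`: `(i, j) ↦ dim_k (R_{i,j} / I_{i,j})`. -/
def hilbertFunction (I : Ideal (CoordRing k)) (i j : ℕ) : ℕ :=
  Module.finrank k (bihomogeneous k i j ⧸ gradedPart I i j)

/-- The ideal `(a₁ x₀ - a₀ x₁, b₁ y₀ - b₀ y₁)` attached to the vectors `a`, `b`. -/
def vectorIdeal (a b : Fin 2 → k) : Ideal (CoordRing k) :=
  Ideal.span {C (a 1) * X (Sum.inl 0) - C (a 0) * X (Sum.inl 1),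
    C (b 1) * X (Sum.inr 0) - C (b 0) * X (Sum.inr 1)}

/-- The bihomogeneous ideal of a point `[a₀ : a₁] × [b₀ : b₁]` of `ℙ¹ × ℙ¹`. -/
def pointIdeal (P : P1 k × P1 k) : Ideal (CoordRing k) :=
  vectorIdeal P.1.rep P.2.rep

lemma vectorIdeal_smul (s t : kˣ) (a b : Fin 2 → k) :
    vectorIdeal (s • a) (t • b) = vectorIdeal a b := by
  have e (u : kˣ) (p q : k) (x y : CoordRing k) :
      C (u • p) * x - C (u • q) * y = (C p * x - C q * y) * C (u : k) := by
    simp only [Units.smul_def, smul_eq_mul, C_mul]; ring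
  have hu (u : kˣ) : IsUnit (C (u : k) : CoordRing k) := u.isUnit.map C
  simp only [vectorIdeal, Pi.smul_apply, e, Ideal.span_insert,
    Ideal.span_singleton_mul_right_unit (hu _)]

/-- The ideal of a point does not depend on the homogeneous coordinates used for it. -/
lemma pointIdeal_mk (a b : Fin 2 → k) (ha : a ≠ 0) (hb : b ≠ 0) :
    pointIdeal (Projectivization.mk k a ha, Projectivization.mk k b hb) = vectorIdeal a b := by
  obtain ⟨s, hs⟩ := Projectivization.exists_smul_eq_mk_rep k a ha
  obtain ⟨t, ht⟩ := Projectivization.exists_smul_eq_mk_rep k b hb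
  simp only [pointIdeal, ← hs, ← ht, vectorIdeal_smul]

end FatPoints

/-- A fat point scheme `Z = {(P; m_P)}` of `ℙ¹ × ℙ¹`: finitely many points of `ℙ¹ × ℙ¹`
(the support of `Z`), each with a positive multiplicity `m_P`; `m_P = 0` off the support. -/
abbrev FatPointScheme (k : Type*) [Field k] : Type _ :=
  (FatPoints.P1 k × FatPoints.P1 k) →₀ ℕ

namespace FatPointScheme

open FatPoints

variable {k : Type*} [Field k]

/-- The defining ideal `I_Z`, the intersection of the powers `℘_P ^ m_P` over the support. -/
def ideal (Z : FatPointScheme k) : Ideal (CoordRing k) :=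
  ⨅ P ∈ Z.support, pointIdeal P ^ Z P

/-- The Hilbert function `H_Z` of `Z`. -/
def hilbert (Z : FatPointScheme k) (i j : ℕ) : ℕ := hilbertFunction Z.ideal i j

open scoped Classical in
/-- The set `{R₁, …, R_r}` of first projections of the points of the support. -/
def proj₁ (Z : FatPointScheme k) : Finset (P1 k) := Z.support.image Prod.fst

open scoped Classical in
/-- The set `{Q₁, …, Q_t}` of second projections of the points of the support. -/
def proj₂ (Z : FatPointScheme k) : Finset (P1 k) := Z.support.image Prod.snd

open scoped Classical in
/-- The points of the support whose first projection is `R`. -/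
def fiber₁ (Z : FatPointScheme k) (R : P1 k) : Finset (P1 k × P1 k) :=
  Z.support.filter fun P => P.1 = R

open scoped Classical in
/-- The points of the support whose second projection is `Q`. -/
def fiber₂ (Z : FatPointScheme k) (Q : P1 k) : Finset (P1 k × P1 k) :=
  Z.support.filter fun P => P.2 = Q

/-- `l_R`, the largest multiplicity of a point of `Z` with first projection `R`. -/
def maxMult₁ (Z : FatPointScheme k) (R : P1 k) : ℕ := (Z.fiber₁ R).sup Z

/-- `l'_Q`, the largest multiplicity of a point of `Z` with second projection `Q`. -/
def maxMult₂ (Z : FatPointScheme k) (Q : P1 k) : ℕ := (Z.fiber₂ Q).sup Z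

/-- `a_{R,n} = ∑ (m_P - n)₊` over the points with first projection `R`; subtraction of
natural numbers is truncated, so `m_P - n` is the positive part. -/
def a (Z : FatPointScheme k) (R : P1 k) (n : ℕ) : ℕ := ∑ P ∈ Z.fiber₁ R, (Z P - n)

/-- `b_{Q,n} = ∑ (m_P - n)₊` over the points with second projection `Q`. -/
def b (Z : FatPointScheme k) (Q : P1 k) (n : ℕ) : ℕ := ∑ P ∈ Z.fiber₂ Q, (Z P - n)

/-- `α_Z`, the tuple of all `a_{R,n}` with `R ∈ {R₁, …, R_r}` and `0 ≤ n ≤ l_R - 1`, as a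
multiset (entries keep their repetitions; the order in which the `R`s are listed is arbitrary). -/
def alpha (Z : FatPointScheme k) : Multiset ℕ :=
  ∑ R ∈ Z.proj₁, (Multiset.range (Z.maxMult₁ R)).map (Z.a R)

/-- `β_Z`, the tuple of all `b_{Q,n}` with `Q ∈ {Q₁, …, Q_t}` and `0 ≤ n ≤ l'_Q - 1`. -/
def beta (Z : FatPointScheme k) : Multiset ℕ :=
  ∑ Q ∈ Z.proj₂, (Multiset.range (Z.maxMult₂ Q)).map (Z.b Q)

/-- Two fat point schemes have the same combinatorial type if their supports are in a bijection
that preserves the multiplicities, the relation "same first projection" and the relation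
"same second projection". -/
def SameType (Z Z' : FatPointScheme k) : Prop :=
  ∃ e : Z.support ≃ Z'.support,
    (∀ P, Z' (e P : P1 k × P1 k) = Z P) ∧
    (∀ P Q, (e P : P1 k × P1 k).1 = (e Q : P1 k × P1 k).1 ↔
      (P : P1 k × P1 k).1 = (Q : P1 k × P1 k).1) ∧
    (∀ P Q, (e P : P1 k × P1 k).2 = (e Q : P1 k × P1 k).2 ↔
      (P : P1 k × P1 k).2 = (Q : P1 k × P1 k).2)

end FatPointScheme

end

/-! Choose points at infinity `[1 : c]` and `[1 : d]` off the projections of the support. In this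
chart `R_{i,j}` becomes the polynomials in `k[Y][X]` of degree at most `i` in `X` and at most `j` in
`Y`. A form lies in `℘_P ^ m`, with `P = (ξ, η)`, iff for every `n < m` its `n`-th Taylor
coefficient in `X` at `ξ` is divisible by `(Y - η) ^ (m - n)` (`mem_affineIdeal_pow_iff`). For the
points over one `R` these powers are coprime, so the conditions on the `n`-th coefficient amount to
divisibility by a single polynomial of degree `a_{R,n}`.

A coefficient of degree at most `j`, reduced modulo that polynomial, ranges over a space of
dimension `min (j + 1) a_{R,n}`. When `i + 1 ≥ ∑ l_R`, Hermite interpolation in `X` makes all these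
coefficients independent (`fiberMap_surjective`), so `H_Z(i,j)` is the sum of the minima. Counting
each minimum by thresholds gives the first formula, and exchanging the factors gives the second. The
third holds because `α_Z`, `β_Z` and both bounds are sums over fibres of functions of the multiset
of multiplicities. -/

noncomputable section

/-! ### Hermite interpolation and Taylor coefficients -/

namespace Polynomial

variable {k : Type*} [Field k]

theorem X_sub_C_pow_dvd_iff_taylor {A : Type*} [CommRing A] (r : A) (p : A[X]) (m : ℕ) :
    (X - C r) ^ m ∣ p ↔ ∀ n < m, (taylor r p).coeff n = 0 := by
  rw [← X_pow_dvd_iff, ← map_dvd_iff (taylorEquiv r)]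
  have h : taylorEquiv r ((X - C r) ^ m) = X ^ m := by
    change taylor r ((X - C r) ^ m) = _
    rw [taylor_pow, map_sub, taylor_X, taylor_C, add_sub_cancel_right]
  rw [h]; rfl

theorem finrank_degreeLT (n : ℕ) : Module.finrank k (degreeLT k n) = n := by
  rw [(degreeLTEquiv k n).finrank_eq]; simp

/-- Hermite interpolation: jets of prescribed lengths at finitely many distinct nodes are
attained by a polynomial of degree less than the sum of the lengths. -/
theorem exists_mem_degreeLT_taylor_coeff_eq {ι : Type*} (s : Finset ι) (ξ : ι → k)
    (hξ : Set.InjOn ξ s) (l : ι → ℕ) (g : ι → ℕ → k) :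
    ∃ p ∈ degreeLT k (∑ u ∈ s, l u), ∀ u ∈ s, ∀ n < l u, (taylor (ξ u) p).coeff n = g u n := by
  let L := ∑ u ∈ s, l u
  let T : degreeLT k L →ₗ[k] ((Σ u : s, Fin (l u)) → k) :=
    (LinearMap.pi fun v => lcoeff k v.2 ∘ₗ taylor (ξ v.1)) ∘ₗ (degreeLT k L).subtype
  have : Module.Finite k (degreeLT k L) := Module.Finite.equiv (degreeLTEquiv k L).symm
  -- A polynomial with zero jets is divisible by a product of degree `L` but has degree less than
  -- `L`. Both sides have dimension `L`, so injectivity yields surjectivity.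
  have hinj : Function.Injective T := by
    rw [← LinearMap.ker_eq_bot, LinearMap.ker_eq_bot']
    rintro ⟨p, hp⟩ h0
    have hdvd : ∏ u ∈ s, (X - C (ξ u)) ^ l u ∣ p := by
      refine Finset.prod_dvd_of_coprime ?_ fun u hu => ?_
      · intro u hu v hv huv
        refine IsCoprime.pow (isCoprime_X_sub_C_of_isUnit_sub ?_)
        exact (sub_ne_zero.2 fun h => huv (hξ hu hv h)).isUnit
      · rw [X_sub_C_pow_dvd_iff_taylor]
        intro n hn
        exact congrFun h0 ⟨⟨u, hu⟩, ⟨n, hn⟩⟩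
    rw [mem_degreeLT] at hp
    ext1
    refine eq_zero_of_dvd_of_degree_lt hdvd (hp.trans_le ?_)
    rw [degree_prod]
    simp [L]
  have hsurj : Function.Surjective T := by
    refine (LinearMap.injective_iff_surjective_of_finrank_eq_finrank ?_).1 hinj
    rw [finrank_degreeLT, Module.finrank_fintype_fun_eq_card, Fintype.card_sigma]
    simp only [Fintype.card_fin]
    exact (Finset.sum_coe_sort s l).symm
  obtain ⟨p, hp⟩ := hsurj fun v => g v.1 v.2
  exact ⟨p, p.2, fun u hu n hn => congrFun hp ⟨⟨u, hu⟩, ⟨n, hn⟩⟩⟩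

/-- With the next lemma, this identifies the image of `degreeLT k n` under reduction modulo `F`; it
is the source of the minima in the dimension count. -/
theorem modByMonic_mem_degreeLT_min {F : k[X]} (hF : F.Monic) {p : k[X]} {n : ℕ}
    (hp : p ∈ degreeLT k n) : p %ₘ F ∈ degreeLT k (min n F.natDegree) := by
  rw [mem_degreeLT] at hp ⊢
  rw [(Nat.mono_cast (α := WithBot ℕ)).map_min, lt_min_iff]
  exact ⟨(degree_modByMonic_le_left).trans_lt hp,
    degree_eq_natDegree hF.ne_zero ▸ degree_modByMonic_lt p hF⟩

theorem modByMonic_eq_self_of_mem_degreeLT_min {F : k[X]} (hF : F.Monic) {p : k[X]} {n : ℕ}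
    (hp : p ∈ degreeLT k (min n F.natDegree)) : p %ₘ F = p := by
  rw [modByMonic_eq_self_iff hF, degree_eq_natDegree hF.ne_zero]
  rw [mem_degreeLT, (Nat.mono_cast (α := WithBot ℕ)).map_min, lt_min_iff] at hp
  exact hp.2

/-- Membership in a power of the ideal `(X - ξ, d)` of `A[X]`, `d ∈ A`, is read off from the
Taylor coefficients at `ξ`. -/
theorem pow_dvd_taylor_coeff_of_mem_span_pow {A : Type*} [CommRing A] (ξ d : A) (m : ℕ)
    {p : A[X]} (hp : p ∈ Ideal.span {X - C ξ, C d} ^ m) (n : ℕ) :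
    d ^ (m - n) ∣ (taylor ξ p).coeff n := by
  induction m generalizing p n with
  | zero => simp
  | succ m ih =>
    rw [pow_succ'] at hp
    refine Submodule.mul_induction_on hp (fun r hr q hq => ?_) fun q r hq hr => ?_
    · obtain ⟨a, b, rfl⟩ := Ideal.mem_span_pair.1 hr
      -- Translation turns `X - ξ` into `X`, which shifts the coefficient index by one, while `C d`
      -- contributes a factor `d`.
      have h : taylor ξ ((a * (X - C ξ) + b * C d) * q) =
          X * taylor ξ (a * q) + C d * taylor ξ (b * q) := by
        simp only [taylor_mul, map_add, map_sub, taylor_X, taylor_C]; ring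
      rw [h, coeff_add, coeff_C_mul]
      refine dvd_add ?_ ?_
      · rcases n with _ | n
        · simp
        · rw [coeff_X_mul, Nat.add_sub_add_right]
          exact ih (Ideal.mul_mem_left _ _ hq) n
      · refine (pow_dvd_pow d (show m + 1 - n ≤ (m - n) + 1 by omega)).trans ?_
        rw [pow_succ']
        exact mul_dvd_mul_left _ (ih (Ideal.mul_mem_left _ _ hq) n)
    · rw [map_add, coeff_add]
      exact dvd_add hq hr

theorem eval_C_mem_degreeLT {p : k[X][X]} {n : ℕ} (hp : ∀ a, p.coeff a ∈ degreeLT k n) (ξ : k) :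
    p.eval (C ξ) ∈ degreeLT k n := by
  rw [eval_eq_sum]
  refine Submodule.sum_mem _ fun a _ => ?_
  beta_reduce
  rw [← C_pow, mul_comm, ← smul_eq_C_mul]
  exact Submodule.smul_mem _ _ (hp a)

/-- The centre is a constant of `k`, so Taylor coefficients are `k`-linear combinations of the
coefficients of `p` and the degree in the inner variable does not grow. -/
theorem taylor_C_coeff_mem_degreeLT {p : k[X][X]} {n : ℕ} (hp : ∀ a, p.coeff a ∈ degreeLT k n)
    (ξ : k) (a : ℕ) : (taylor (C ξ) p).coeff a ∈ degreeLT k n := by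
  rw [taylor_coeff]
  refine eval_C_mem_degreeLT (fun b => ?_) ξ
  rw [hasseDeriv_coeff, ← nsmul_eq_mul]
  exact Submodule.smul_of_tower_mem _ _ (hp _)

theorem taylor_map_C_mul_C_coeff (p q : k[X]) (ξ : k) (n : ℕ) :
    (taylor (C ξ) (p.map C * C q)).coeff n = (taylor ξ p).coeff n • q := by
  rw [taylor_mul, taylor_C, coeff_mul_C, ← map_taylor, coeff_map, smul_eq_C_mul]

end Polynomial

/-! ### Forms and ideals of points in an affine chart -/

namespace FatPoints

variable {k : Type*} [Field k]

/-- The form `y₁ - c y₀` in the two variables `y = X ∘ s`. -/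
def infinityForm (s : Fin 2 → Fin 2 ⊕ Fin 2) (c : k) : CoordRing k :=
  X (s 1) - C c * X (s 0)

/-- The form `y₀ - ξ (y₁ - c y₀)`, whose dehomogenization is `y - ξ`. -/
def affineForm (s : Fin 2 → Fin 2 ⊕ Fin 2) (c ξ : k) : CoordRing k :=
  X (s 0) - C ξ * infinityForm s c

/-- Dehomogenization along `x₁ = 1 + c x₀`, `y₁ = 1 + d y₀`. -/
def dehom (c d : k) : CoordRing k →ₐ[k] Polynomial (Polynomial k) :=
  aeval (Sum.elim
    ![Polynomial.X, 1 + Polynomial.C (Polynomial.C c) * Polynomial.X]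
    ![Polynomial.C Polynomial.X,
      Polynomial.C (1 + Polynomial.C d * Polynomial.X)])

@[simp] lemma dehom_X_inl_zero (c d : k) : dehom c d (X (Sum.inl 0)) = Polynomial.X := by
  simp [dehom]

@[simp] lemma dehom_X_inl_one (c d : k) :
    dehom c d (X (Sum.inl 1)) = 1 + Polynomial.C (Polynomial.C c) * Polynomial.X := by
  simp [dehom]

@[simp] lemma dehom_X_inr_zero (c d : k) :
    dehom c d (X (Sum.inr 0)) = Polynomial.C Polynomial.X := by
  simp [dehom]

@[simp] lemma dehom_X_inr_one (c d : k) :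
    dehom c d (X (Sum.inr 1)) = Polynomial.C (1 + Polynomial.C d * Polynomial.X) := by
  simp [dehom]

@[simp] lemma dehom_C (c d a : k) :
    dehom c d (C a) = Polynomial.C (Polynomial.C a) := by
  simp only [dehom, algHom_C]; rfl

@[simp] lemma dehom_infinityForm_inl (c d : k) : dehom c d (infinityForm Sum.inl c) = 1 := by
  simp [infinityForm]

@[simp] lemma dehom_infinityForm_inr (c d : k) : dehom c d (infinityForm Sum.inr d) = 1 := by
  simp [infinityForm]

@[simp] lemma dehom_affineForm_inl (c d ξ : k) : dehom c d (affineForm Sum.inl c ξ) =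
    Polynomial.X - Polynomial.C (Polynomial.C ξ) := by
  simp [affineForm]

@[simp] lemma dehom_affineForm_inr (c d η : k) : dehom c d (affineForm Sum.inr d η) =
    Polynomial.C (Polynomial.X - Polynomial.C η) := by
  simp [affineForm]

lemma X_inl_mem (a : Fin 2) : (X (Sum.inl a) : CoordRing k) ∈ bihomogeneous k 1 0 :=
  isWeightedHomogeneous_X k bidegree (Sum.inl a)

lemma X_inr_mem (a : Fin 2) : (X (Sum.inr a) : CoordRing k) ∈ bihomogeneous k 0 1 :=
  isWeightedHomogeneous_X k bidegree (Sum.inr a)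

lemma C_mul_mem {i j : ℕ} {f : CoordRing k} (hf : f ∈ bihomogeneous k i j) (a : k) :
    C a * f ∈ bihomogeneous k i j := by
  rw [← smul_eq_C_mul]; exact Submodule.smul_mem _ _ hf

lemma mul_mem_bihomogeneous {i j i' j' : ℕ} {f g : CoordRing k} (hf : f ∈ bihomogeneous k i j)
    (hg : g ∈ bihomogeneous k i' j') : f * g ∈ bihomogeneous k (i + i') (j + j') :=
  IsWeightedHomogeneous.mul hf hg

lemma pow_mem_bihomogeneous {i j : ℕ} {f : CoordRing k} (hf : f ∈ bihomogeneous k i j) (n : ℕ) :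
    f ^ n ∈ bihomogeneous k (n * i) (n * j) := by
  simpa [bihomogeneous, mem_weightedHomogeneousSubmodule] using IsWeightedHomogeneous.pow hf n

lemma infinityForm_inl_mem (c : k) : infinityForm Sum.inl c ∈ bihomogeneous k 1 0 :=
  Submodule.sub_mem _ (X_inl_mem 1) (C_mul_mem (X_inl_mem 0) c)

lemma infinityForm_inr_mem (c : k) : infinityForm Sum.inr c ∈ bihomogeneous k 0 1 :=
  Submodule.sub_mem _ (X_inr_mem 1) (C_mul_mem (X_inr_mem 0) c)

lemma affineForm_inl_mem (c ξ : k) : affineForm Sum.inl c ξ ∈ bihomogeneous k 1 0 :=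
  Submodule.sub_mem _ (X_inl_mem 0) (C_mul_mem (infinityForm_inl_mem c) ξ)

lemma affineForm_inr_mem (c ξ : k) : affineForm Sum.inr c ξ ∈ bihomogeneous k 0 1 :=
  Submodule.sub_mem _ (X_inr_mem 0) (C_mul_mem (infinityForm_inr_mem c) ξ)

/-- The monomial of degree `(n, q)` in the coordinates centred at `(ξ, η)`, homogenized to
bidegree `(i, j)`. -/
def homMonomial (c d ξ η : k) (i j n q : ℕ) : CoordRing k :=
  affineForm Sum.inl c ξ ^ n * infinityForm Sum.inl c ^ (i - n) *
    (affineForm Sum.inr d η ^ q * infinityForm Sum.inr d ^ (j - q))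

lemma homMonomial_mem (c d ξ η : k) {i j n q : ℕ} (hn : n ≤ i) (hq : q ≤ j) :
    homMonomial c d ξ η i j n q ∈ bihomogeneous k i j := by
  have h := mul_mem_bihomogeneous
    (mul_mem_bihomogeneous (pow_mem_bihomogeneous (affineForm_inl_mem c ξ) n)
      (pow_mem_bihomogeneous (infinityForm_inl_mem c) (i - n)))
    (mul_mem_bihomogeneous (pow_mem_bihomogeneous (affineForm_inr_mem d η) q)
      (pow_mem_bihomogeneous (infinityForm_inr_mem d) (j - q)))
  convert! h using 2 <;> omega

lemma dehom_homMonomial (c d ξ η : k) (i j n q : ℕ) :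
    dehom c d (homMonomial c d ξ η i j n q) =
      (Polynomial.X - Polynomial.C (Polynomial.C ξ)) ^ n *
        Polynomial.C ((Polynomial.X - Polynomial.C η) ^ q) := by
  simp [homMonomial]

/-- The coefficients of the expansion of `p` in powers of `X - ξ` and `Y - η`. -/
def jetCoeff (ξ η : k) (p : Polynomial (Polynomial k)) (n q : ℕ) : k :=
  (Polynomial.taylor η ((Polynomial.taylor (Polynomial.C ξ) p).coeff n)).coeff q

/-- The homogenization in bidegree `(i, j)` of `p`, expanded around `(ξ, η)`. -/
def homogenize (c d ξ η : k) (i j : ℕ) (p : Polynomial (Polynomial k)) : CoordRing k :=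
  ∑ n ∈ Finset.range (i + 1), ∑ q ∈ Finset.range (j + 1),
    C (jetCoeff ξ η p n q) * homMonomial c d ξ η i j n q

lemma homogenize_mem (c d ξ η : k) (i j : ℕ) (p : Polynomial (Polynomial k)) :
    homogenize c d ξ η i j p ∈ bihomogeneous k i j :=
  Submodule.sum_mem _ fun _ hn => Submodule.sum_mem _ fun _ hq =>
    C_mul_mem (homMonomial_mem c d ξ η (Nat.lt_succ_iff.1 (Finset.mem_range.1 hn))
      (Nat.lt_succ_iff.1 (Finset.mem_range.1 hq))) _

lemma sum_taylor_coeff_mul_pow {A : Type*} [CommRing A] (r : A) (p : Polynomial A) (n : ℕ)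
    (hp : p.natDegree < n) :
    ∑ m ∈ Finset.range n, Polynomial.C ((Polynomial.taylor r p).coeff m) *
      (Polynomial.X - Polynomial.C r) ^ m = p := by
  conv_rhs => rw [← Polynomial.sum_taylor_eq p r]
  rw [Polynomial.sum_over_range' _ _ n (by rwa [Polynomial.natDegree_taylor])]
  simp

/-- The degree bounds survive translation to `(ξ, η)`, so the truncated double Taylor expansion
loses no term. -/
lemma dehom_homogenize (c d ξ η : k) (i j : ℕ) {p : Polynomial (Polynomial k)}
    (hp : p.natDegree ≤ i) (hp' : ∀ n, p.coeff n ∈ Polynomial.degreeLT k (j + 1)) :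
    dehom c d (homogenize c d ξ η i j p) = p := by
  have hdeg : ∀ n, ((Polynomial.taylor (Polynomial.C ξ) p).coeff n).natDegree < j + 1 := by
    intro n
    have h := Polynomial.taylor_C_coeff_mem_degreeLT hp' ξ n
    rw [Polynomial.mem_degreeLT] at h
    by_cases h0 : (Polynomial.taylor (Polynomial.C ξ) p).coeff n = 0
    · simp [h0]
    · exact (Polynomial.natDegree_lt_iff_degree_lt h0).2 h
  rw [homogenize, map_sum]
  conv_rhs => rw [← sum_taylor_coeff_mul_pow (Polynomial.C ξ) p (i + 1) (by omega)]
  refine Finset.sum_congr rfl fun n _ => ?_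
  conv_rhs => rw [← sum_taylor_coeff_mul_pow η _ (j + 1) (hdeg n)]
  rw [map_sum, map_sum, Finset.sum_mul]
  refine Finset.sum_congr rfl fun q _ => ?_
  rw [map_mul, dehom_homMonomial, dehom_C, jetCoeff, Polynomial.C_mul]
  ring

lemma finsupp_bidegree (e : Fin 2 ⊕ Fin 2 →₀ ℕ) : Finsupp.weight bidegree e =
    (e (Sum.inl 0) + e (Sum.inl 1), e (Sum.inr 0) + e (Sum.inr 1)) := by
  simp [Finsupp.weight_apply, Finsupp.sum_fintype, bidegree, Prod.ext_iff]

lemma aeval_eq_sum {A : Type*} [CommRing A] [Algebra k A] {f : CoordRing k}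
    (v : Fin 2 ⊕ Fin 2 → A) : aeval v f = ∑ e ∈ f.support,
      algebraMap k A (f.coeff e) * ((v (Sum.inl 0) ^ e (Sum.inl 0) * v (Sum.inl 1) ^ e (Sum.inl 1)) *
        (v (Sum.inr 0) ^ e (Sum.inr 0) * v (Sum.inr 1) ^ e (Sum.inr 1))) := by
  rw [aeval_def, eval₂_eq']
  simp

lemma degree_of_mem {i j : ℕ} {f : CoordRing k} (hf : f ∈ bihomogeneous k i j)
    {e : Fin 2 ⊕ Fin 2 →₀ ℕ} (he : e ∈ f.support) :
    e (Sum.inl 0) + e (Sum.inl 1) = i ∧ e (Sum.inr 0) + e (Sum.inr 1) = j := by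
  have h := hf (mem_support_iff.mp he)
  rw [finsupp_bidegree] at h
  exact Prod.ext_iff.1 h

lemma aeval_smul_of_mem {A : Type*} [CommRing A] [Algebra k A] {i j : ℕ} {f : CoordRing k}
    (hf : f ∈ bihomogeneous k i j) (v : Fin 2 ⊕ Fin 2 → A) (s t : A) :
    aeval (fun b => Sum.elim (fun _ => s) (fun _ => t) b * v b) f = s ^ i * t ^ j * aeval v f := by
  rw [aeval_eq_sum, aeval_eq_sum, Finset.mul_sum]
  refine Finset.sum_congr rfl fun e he => ?_
  obtain ⟨rfl, rfl⟩ := degree_of_mem hf he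
  simp only [Sum.elim_inl, Sum.elim_inr]
  ring

lemma dehom_mem {i j : ℕ} {f : CoordRing k} (hf : f ∈ bihomogeneous k i j) (c d : k) :
    (dehom c d f).natDegree ≤ i ∧
      ∀ n, (dehom c d f).coeff n ∈ Polynomial.degreeLT k (j + 1) := by
  have key : ∀ n, (i < n → (dehom c d f).coeff n = 0) ∧
      (dehom c d f).coeff n ∈ Polynomial.degreeLT k (j + 1) := by
    intro n
    rw [dehom, aeval_eq_sum, Polynomial.finsetSum_coeff]
    -- Each monomial dehomogenizes to a polynomial in `X` times a polynomial in `Y`, with degrees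
    -- bounded separately.
    have hterm : ∀ e ∈ f.support, ∃ p q : Polynomial k, p.natDegree ≤ i ∧
        q ∈ Polynomial.degreeLT k (j + 1) ∧
        (algebraMap k (Polynomial (Polynomial k)) (f.coeff e) *
          (Polynomial.X ^ e (Sum.inl 0) *
            (1 + Polynomial.C (Polynomial.C c) * Polynomial.X) ^ e (Sum.inl 1) *
          (Polynomial.C Polynomial.X ^ e (Sum.inr 0) *
            Polynomial.C (1 + Polynomial.C d * Polynomial.X) ^ e (Sum.inr 1)))).coeff n =
          p.coeff n • q := by
      intro e he
      obtain ⟨rfl, rfl⟩ := degree_of_mem hf he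
      refine ⟨Polynomial.C (f.coeff e) *
          (Polynomial.X ^ e (Sum.inl 0) * (1 + Polynomial.C c * Polynomial.X) ^ e (Sum.inl 1)),
        Polynomial.X ^ e (Sum.inr 0) * (1 + Polynomial.C d * Polynomial.X) ^ e (Sum.inr 1),
        ?_, ?_, ?_⟩
      · compute_degree
      · rw [Polynomial.mem_degreeLT]
        refine (Polynomial.degree_le_of_natDegree_le (n := e (Sum.inr 0) + e (Sum.inr 1))
          (by compute_degree)).trans_lt ?_
        exact_mod_cast Nat.lt_succ_self _
      · rw [Polynomial.smul_eq_C_mul, ← Polynomial.coeff_map, ← Polynomial.coeff_mul_C]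
        congr 1
        simp
        ring
    choose! p q hp hq hpq using hterm
    simp only [Sum.elim_inl, Sum.elim_inr, Matrix.cons_val_zero, Matrix.cons_val_one]
    rw [Finset.sum_congr rfl hpq]
    refine ⟨fun hn => Finset.sum_eq_zero fun e he => ?_, Submodule.sum_mem _ fun e he =>
      Submodule.smul_mem _ _ (hq e he)⟩
    rw [Polynomial.coeff_eq_zero_of_natDegree_lt ((hp e he).trans_lt hn), zero_smul]
  exact ⟨Polynomial.natDegree_le_iff_coeff_eq_zero.2 fun n hn => (key n).1 hn,
    fun n => (key n).2⟩

lemma infinityForm_ne_zero {s : Fin 2 → Fin 2 ⊕ Fin 2} (hs : s 0 ≠ s 1) (c : k) :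
    infinityForm s c ≠ 0 := by
  intro h
  have := congrArg (eval (Pi.single (s 1) 1)) h
  simp [infinityForm, hs] at this

/-- Substituting `x₀ / N` and `y₀ / K` back, where `N` and `K` are the forms at infinity, turns the
dehomogenization into `N⁻¹ ^ i * K⁻¹ ^ j * f` in the fraction field. -/
lemma eq_zero_of_dehom_eq_zero {i j : ℕ} {f : CoordRing k} (hf : f ∈ bihomogeneous k i j) {c d : k}
    (h0 : dehom c d f = 0) : f = 0 := by
  let F := FractionRing (CoordRing k)
  let x (b : Fin 2 ⊕ Fin 2) : F := algebraMap (CoordRing k) F (X b)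
  let N : F := algebraMap _ F (infinityForm Sum.inl c)
  let K : F := algebraMap _ F (infinityForm Sum.inr d)
  have hN : N ≠ 0 := by
    simpa [N] using infinityForm_ne_zero (k := k) (s := Sum.inl) (by simp) c
  have hK : K ≠ 0 := by
    simpa [K] using infinityForm_ne_zero (k := k) (s := Sum.inr) (by simp) d
  let Ψ : Polynomial (Polynomial k) →+* F :=
    Polynomial.eval₂RingHom
      (Polynomial.aeval (K⁻¹ * x (Sum.inr 0)) : Polynomial k →ₐ[k] F).toRingHom
      (N⁻¹ * x (Sum.inl 0))
  have hC (a : k) : algebraMap k F a = algebraMap (CoordRing k) F (C a) :=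
    IsScalarTower.algebraMap_apply k (CoordRing k) F a
  have hNe : N = x (Sum.inl 1) - algebraMap k F c * x (Sum.inl 0) := by
    rw [hC]; simp [N, x, infinityForm]
  have hKe : K = x (Sum.inr 1) - algebraMap k F d * x (Sum.inr 0) := by
    rw [hC]; simp [K, x, infinityForm]
  have hx1 : 1 + algebraMap k F c * (N⁻¹ * x (Sum.inl 0)) = N⁻¹ * x (Sum.inl 1) := by
    linear_combination N⁻¹ * hNe - inv_mul_cancel₀ hN
  have hy1 : 1 + algebraMap k F d * (K⁻¹ * x (Sum.inr 0)) = K⁻¹ * x (Sum.inr 1) := by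
    linear_combination K⁻¹ * hKe - inv_mul_cancel₀ hK
  have hcomp : Ψ.comp (dehom c d).toRingHom =
      (aeval (fun b => Sum.elim (fun _ => N⁻¹) (fun _ => K⁻¹) b * x b) :
        CoordRing k →ₐ[k] F).toRingHom := by
    refine MvPolynomial.ringHom_ext (fun a => ?_) fun b => ?_
    · simp [Ψ]
    · rcases b with b | b <;> fin_cases b
      · simp [Ψ]
      · simpa [Ψ] using hx1
      · simp [Ψ]
      · simpa [Ψ] using hy1
  have h1 := congrArg (fun φ => φ f) hcomp
  have h2 : aeval x f = algebraMap (CoordRing k) F f := by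
    have : (aeval x : CoordRing k →ₐ[k] F) = IsScalarTower.toAlgHom k (CoordRing k) F := by
      ext b; simp [x]
    rw [this]; rfl
  simp only [RingHom.comp_apply, AlgHom.toRingHom_eq_coe, RingHom.coe_coe, h0, map_zero,
    aeval_smul_of_mem hf, h2] at h1
  simpa [hN, hK] using h1.symm

/-- Both sides have the same dehomogenization. The centre is free, so that a form can be expanded
around the very point under study. -/
lemma homogenize_dehom {i j : ℕ} {f : CoordRing k} (hf : f ∈ bihomogeneous k i j)
    (c d ξ η : k) : homogenize c d ξ η i j (dehom c d f) = f := by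
  refine sub_eq_zero.1 (eq_zero_of_dehom_eq_zero (c := c) (d := d)
    (Submodule.sub_mem _ (homogenize_mem c d ξ η i j _) hf) ?_)
  rw [map_sub, dehom_homogenize c d ξ η i j (dehom_mem hf c d).1 (dehom_mem hf c d).2, sub_self]

/-- The ideal of the point with affine coordinates `(ξ, η)`. -/
def affineIdeal (c d ξ η : k) : Ideal (CoordRing k) :=
  Ideal.span {affineForm Sum.inl c ξ, affineForm Sum.inr d η}

lemma homMonomial_mem_pow (c d ξ η : k) {i j n q m : ℕ} (h : m ≤ n + q) :
    homMonomial c d ξ η i j n q ∈ affineIdeal c d ξ η ^ m := by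
  refine Ideal.pow_le_pow_right h ?_
  rw [homMonomial, mul_mul_mul_comm, pow_add]
  exact Ideal.mul_mem_right _ _ (Ideal.mul_mem_mul
    (Ideal.pow_mem_pow (Ideal.subset_span (by simp)) n)
    (Ideal.pow_mem_pow (Ideal.subset_span (by simp)) q))

/-- A bihomogeneous form lies in the `m`-th power of the ideal of a point iff its
dehomogenization vanishes to order `m` there. -/
lemma mem_affineIdeal_pow_iff {i j : ℕ} {f : CoordRing k} (hf : f ∈ bihomogeneous k i j)
    (c d ξ η : k) (m : ℕ) : f ∈ affineIdeal c d ξ η ^ m ↔ ∀ n < m,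
      (Polynomial.X - Polynomial.C η) ^ (m - n) ∣
        (Polynomial.taylor (Polynomial.C ξ) (dehom c d f)).coeff n := by
  refine ⟨fun h n _ => ?_, fun h => ?_⟩
  · refine Polynomial.pow_dvd_taylor_coeff_of_mem_span_pow _ _ m ?_ n
    have := Ideal.mem_map_of_mem (dehom c d) h
    rwa [Ideal.map_pow, affineIdeal, Ideal.map_span, Set.image_pair, dehom_affineForm_inl,
      dehom_affineForm_inr] at this
  -- In the expansion around the point, the terms with `n + q < m` have zero coefficient and the
  -- others lie in the power of the ideal.
  · rw [← homogenize_dehom hf c d ξ η]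
    refine Ideal.sum_mem _ fun n _ => Ideal.sum_mem _ fun q _ => ?_
    by_cases hnq : m ≤ n + q
    · exact Ideal.mul_mem_left _ _ (homMonomial_mem_pow c d ξ η hnq)
    · have h1 := (Polynomial.X_sub_C_pow_dvd_iff_taylor _ _ _).1 (h n (by omega)) q (by omega)
      rw [jetCoeff, h1, C_0, zero_mul]
      exact zero_mem _

/-- The affine coordinate of a point of the projective line, for the point at infinity
`[1 : c]`. -/
def coord (c : k) (R : P1 k) : k := R.rep 0 / (R.rep 1 - c * R.rep 0)

/-- Each point excludes at most the one value `R.rep 1 / R.rep 0`, and `[0 : 1]` excludes none. -/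
lemma exists_forall_rep_ne [Infinite k] (s : Finset (P1 k)) :
    ∃ c : k, ∀ R ∈ s, R.rep 1 - c * R.rep 0 ≠ 0 := by
  classical
  obtain ⟨c, hc⟩ := Infinite.exists_notMem_finset (s.image fun R => R.rep 1 / R.rep 0)
  refine ⟨c, fun R hR h => ?_⟩
  by_cases h0 : R.rep 0 = 0
  · refine R.rep_nonzero (funext fun a => ?_)
    fin_cases a
    · exact h0
    · simpa [h0] using h
  · exact hc (Finset.mem_image.2 ⟨R, hR, by rw [div_eq_iff h0]; exact sub_eq_zero.1 h⟩)

lemma coord_injOn (c : k) : Set.InjOn (coord c) {R | R.rep 1 - c * R.rep 0 ≠ 0} := by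
  intro R hR S hS h
  rw [Set.mem_ofPred_eq] at hR hS
  rw [coord, coord, div_eq_div_iff hR hS] at h
  rw [← R.mk_rep, ← S.mk_rep, Projectivization.mk_eq_mk_iff']
  -- Representatives scaled to value 1 on the form at infinity are determined by `coord`; the scalar
  -- compares the two values.
  refine ⟨(R.rep 1 - c * R.rep 0) / (S.rep 1 - c * S.rep 0), funext fun a => ?_⟩
  fin_cases a
  · simp only [Fin.zero_eta, Pi.smul_apply, smul_eq_mul]
    field_simp
    linear_combination -h
  · simp only [Fin.mk_one, Pi.smul_apply, smul_eq_mul]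
    field_simp
    linear_combination (-c) * h

lemma coordForm_eq (s : Fin 2 → Fin 2 ⊕ Fin 2) {c : k} {R : P1 k}
    (hR : R.rep 1 - c * R.rep 0 ≠ 0) :
    C (R.rep 1) * X (s 0) - C (R.rep 0) * X (s 1) =
      affineForm s c (coord c R) * C (R.rep 1 - c * R.rep 0) := by
  have h : (C (R.rep 0) : CoordRing k) = C (coord c R) * C (R.rep 1 - c * R.rep 0) := by
    rw [← C_mul, coord, div_mul_cancel₀ _ hR]
  have h' : (C (R.rep 1 - c * R.rep 0) : CoordRing k) = C (R.rep 1) - C c * C (R.rep 0) := by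
    simp
  rw [affineForm, infinityForm]
  linear_combination (C c * X (s 0) - X (s 1)) * h - X (s 0) * h'

lemma pointIdeal_eq_affineIdeal {c d : k} {P : P1 k × P1 k}
    (h1 : P.1.rep 1 - c * P.1.rep 0 ≠ 0) (h2 : P.2.rep 1 - d * P.2.rep 0 ≠ 0) :
    pointIdeal P = affineIdeal c d (coord c P.1) (coord d P.2) := by
  have hu {a : k} (ha : a ≠ 0) : IsUnit (C a : CoordRing k) := ha.isUnit.map C
  rw [pointIdeal, vectorIdeal, coordForm_eq Sum.inl h1, coordForm_eq Sum.inr h2, affineIdeal,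
    Ideal.span_insert, Ideal.span_insert, Ideal.span_singleton_mul_right_unit (hu h1),
    Ideal.span_singleton_mul_right_unit (hu h2)]

end FatPoints

/-! ### Conditions along the fibres and the dimension count -/

namespace FatPointScheme

open FatPoints

variable {k : Type*} [Field k]

lemma mem_fiber₁ {Z : FatPointScheme k} {R : P1 k} {P : P1 k × P1 k} :
    P ∈ Z.fiber₁ R ↔ P ∈ Z.support ∧ P.1 = R := by
  classical
  simp [fiber₁]

lemma fst_mem_proj₁ {Z : FatPointScheme k} {P : P1 k × P1 k} (hP : P ∈ Z.support) :
    P.1 ∈ Z.proj₁ := by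
  classical
  exact Finset.mem_image_of_mem _ hP

lemma mem_ideal_iff {Z : FatPointScheme k} {f : CoordRing k} :
    f ∈ Z.ideal ↔ ∀ P ∈ Z.support, f ∈ pointIdeal P ^ Z P := by
  simp only [ideal, Submodule.mem_iInf]

/-- The polynomial whose divisibility expresses the conditions imposed by the points over `R` on
the `n`-th Taylor coefficient. -/
def fiberPoly (Z : FatPointScheme k) (d : k) (R : P1 k) (n : ℕ) : Polynomial k :=
  ∏ P ∈ Z.fiber₁ R, (Polynomial.X - Polynomial.C (coord d P.2)) ^ (Z P - n)

lemma fiberPoly_monic (Z : FatPointScheme k) (d : k) (R : P1 k) (n : ℕ) :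
    (Z.fiberPoly d R n).Monic :=
  Polynomial.monic_prod_of_monic _ _ fun _ _ => (Polynomial.monic_X_sub_C _).pow _

lemma natDegree_fiberPoly (Z : FatPointScheme k) (d : k) (R : P1 k) (n : ℕ) :
    (Z.fiberPoly d R n).natDegree = Z.a R n := by
  rw [fiberPoly, Polynomial.natDegree_prod_of_monic _ _
    fun _ _ => (Polynomial.monic_X_sub_C _).pow _]
  simp [a]

/-- Distinct points of one fibre differ in the second coordinate, so the factors are pairwise
coprime. -/
lemma fiberPoly_dvd_iff {Z : FatPointScheme k} {d : k}
    (hd : ∀ P ∈ Z.support, P.2.rep 1 - d * P.2.rep 0 ≠ 0) (R : P1 k) (n : ℕ)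
    (g : Polynomial k) : Z.fiberPoly d R n ∣ g ↔
      ∀ P ∈ Z.fiber₁ R, (Polynomial.X - Polynomial.C (coord d P.2)) ^ (Z P - n) ∣ g := by
  rw [fiberPoly]
  refine ⟨fun h P hP => (Finset.dvd_prod_of_mem (fun P : P1 k × P1 k =>
    (Polynomial.X - Polynomial.C (coord d P.2)) ^ (Z P - n)) hP).trans h, fun h =>
    Finset.prod_dvd_of_coprime (fun P hP Q hQ hPQ => ?_) h⟩
  refine IsCoprime.pow (Polynomial.isCoprime_X_sub_C_of_isUnit_sub ?_)
  rw [Finset.mem_coe, mem_fiber₁] at hP hQ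
  refine (sub_ne_zero.2 fun h => hPQ (Prod.ext (hP.2.trans hQ.2.symm) ?_)).isUnit
  exact coord_injOn d (hd P hP.1) (hd Q hQ.1) h

lemma mem_ideal_iff_fiberPoly {Z : FatPointScheme k} {c d : k}
    (hc : ∀ P ∈ Z.support, P.1.rep 1 - c * P.1.rep 0 ≠ 0)
    (hd : ∀ P ∈ Z.support, P.2.rep 1 - d * P.2.rep 0 ≠ 0) {i j : ℕ} {f : CoordRing k}
    (hf : f ∈ bihomogeneous k i j) : f ∈ Z.ideal ↔ ∀ R ∈ Z.proj₁, ∀ n < Z.maxMult₁ R,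
      Z.fiberPoly d R n ∣
        (Polynomial.taylor (Polynomial.C (coord c R)) (dehom c d f)).coeff n := by
  simp only [mem_ideal_iff, fiberPoly_dvd_iff hd]
  constructor
  · intro h R _ n _ P hP
    obtain ⟨hZ, rfl⟩ := mem_fiber₁.1 hP
    by_cases hn : n < Z P
    · have := h P hZ
      rw [pointIdeal_eq_affineIdeal (hc P hZ) (hd P hZ), mem_affineIdeal_pow_iff hf] at this
      exact this n hn
    -- A point whose multiplicity is at most `n` imposes nothing: its exponent truncates to 0.
    · rw [Nat.sub_eq_zero_of_le (not_lt.1 hn), pow_zero]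
      exact one_dvd _
  · intro h P hP
    rw [pointIdeal_eq_affineIdeal (hc P hP) (hd P hP), mem_affineIdeal_pow_iff hf]
    exact fun n hn => h P.1 (fst_mem_proj₁ hP) n
      (hn.trans_le (Finset.le_sup (f := Z) (mem_fiber₁.2 ⟨hP, rfl⟩))) P (mem_fiber₁.2 ⟨hP, rfl⟩)

/-- Reduction of the Taylor coefficients along the lines through the points of `Z`. -/
def fiberMap (Z : FatPointScheme k) (c d : k) (i j : ℕ) :
    bihomogeneous k i j →ₗ[k] ((v : Σ R : Z.proj₁, Fin (Z.maxMult₁ R)) →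
      Polynomial.degreeLT k (min (j + 1) (Z.fiberPoly d v.1 v.2).natDegree)) :=
  LinearMap.pi fun v =>
    ((Polynomial.modByMonicHom (Z.fiberPoly d v.1 v.2)) ∘ₗ
      ((Polynomial.lcoeff (Polynomial k) v.2).restrictScalars k) ∘ₗ
      ((Polynomial.taylor (Polynomial.C (coord c v.1))).restrictScalars k) ∘ₗ
      (dehom c d).toLinearMap ∘ₗ (bihomogeneous k i j).subtype).codRestrict _ fun f =>
        Polynomial.modByMonic_mem_degreeLT_min (fiberPoly_monic _ _ _ _)
          (Polynomial.taylor_C_coeff_mem_degreeLT (dehom_mem f.2 c d).2 _ _)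

lemma fiberMap_apply (Z : FatPointScheme k) (c d : k) (i j : ℕ) (f : bihomogeneous k i j)
    (v : Σ R : Z.proj₁, Fin (Z.maxMult₁ R)) : (Z.fiberMap c d i j f v : Polynomial k) =
      (Polynomial.taylor (Polynomial.C (coord c v.1)) (dehom c d f)).coeff v.2 %ₘ
        Z.fiberPoly d v.1 v.2 := rfl

lemma ker_fiberMap {Z : FatPointScheme k} {c d : k}
    (hc : ∀ P ∈ Z.support, P.1.rep 1 - c * P.1.rep 0 ≠ 0)
    (hd : ∀ P ∈ Z.support, P.2.rep 1 - d * P.2.rep 0 ≠ 0) (i j : ℕ) :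
    LinearMap.ker (Z.fiberMap c d i j) = gradedPart Z.ideal i j := by
  ext f
  have : f ∈ gradedPart Z.ideal i j ↔ (f : CoordRing k) ∈ Z.ideal := Iff.rfl
  rw [this, mem_ideal_iff_fiberPoly hc hd f.2, LinearMap.mem_ker, funext_iff]
  simp only [Subtype.ext_iff, fiberMap_apply, Pi.zero_apply, ZeroMemClass.coe_zero,
    Polynomial.modByMonic_eq_zero_iff_dvd (fiberPoly_monic _ _ _ _)]
  exact ⟨fun h R hR n hn => h ⟨⟨R, hR⟩, ⟨n, hn⟩⟩, fun h v => h v.1 v.1.2 v.2 v.2.2⟩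

/-- Interpolation in `X` alone gives polynomials `e v` dual to the Taylor functionals, of degree at
most `i` by `hi`. Then `∑ e v (X) * g v (Y)` has Taylor coefficients `g v`, already reduced. -/
lemma fiberMap_surjective {Z : FatPointScheme k} {c : k}
    (hc : ∀ P ∈ Z.support, P.1.rep 1 - c * P.1.rep 0 ≠ 0) (d : k) {i : ℕ}
    (hi : ∑ R ∈ Z.proj₁, Z.maxMult₁ R ≤ i + 1) (j : ℕ) :
    Function.Surjective (Z.fiberMap c d i j) := by
  classical
  intro g
  have hinj : Set.InjOn (coord c) (Z.proj₁ : Set (P1 k)) := by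
    refine (coord_injOn c).mono fun R hR => ?_
    obtain ⟨P, hP, rfl⟩ := Finset.mem_image.1 hR
    exact hc P hP
  choose e he he' using fun v : Σ R : Z.proj₁, Fin (Z.maxMult₁ R) =>
    Polynomial.exists_mem_degreeLT_taylor_coeff_eq Z.proj₁ (coord c) hinj Z.maxMult₁
      fun R n => if R = v.1 ∧ n = v.2 then 1 else 0
  let p : Polynomial (Polynomial k) := ∑ v, (e v).map Polynomial.C * Polynomial.C (g v : Polynomial k)
  have hp : p.natDegree ≤ i := by
    refine Polynomial.natDegree_sum_le_of_forall_le _ _ fun v _ => ?_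
    refine Polynomial.natDegree_mul_C_le _ _ |>.trans (Polynomial.natDegree_map_le.trans ?_)
    have := Polynomial.mem_degreeLT.1 (Polynomial.degreeLT_mono hi (he v))
    exact Polynomial.natDegree_le_iff_coeff_eq_zero.2
      ((Polynomial.degree_lt_iff_coeff_zero _ _).1 this)
  have hp' : ∀ n, p.coeff n ∈ Polynomial.degreeLT k (j + 1) := by
    intro n
    rw [Polynomial.finsetSum_coeff]
    refine Submodule.sum_mem _ fun v _ => ?_
    rw [Polynomial.coeff_mul_C, Polynomial.coeff_map, ← Polynomial.smul_eq_C_mul]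
    exact Submodule.smul_mem _ _ (Polynomial.degreeLT_mono (min_le_left _ _) (g v).2)
  -- Any centre would do; `(0, 0)` is a convenience.
  refine ⟨⟨homogenize c d 0 0 i j p, homogenize_mem c d 0 0 i j p⟩, funext fun v => ?_⟩
  rw [Subtype.ext_iff, fiberMap_apply, dehom_homogenize c d 0 0 i j hp hp', map_sum,
    Polynomial.finsetSum_coeff, Finset.sum_eq_single v]
  · rw [Polynomial.taylor_map_C_mul_C_coeff, he' v v.1 v.1.2 v.2 v.2.2, if_pos ⟨rfl, rfl⟩, one_smul]
    exact Polynomial.modByMonic_eq_self_of_mem_degreeLT_min (fiberPoly_monic _ _ _ _) (g v).2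
  · intro w _ hw
    rw [Polynomial.taylor_map_C_mul_C_coeff, he' w v.1 v.1.2 v.2 v.2.2, if_neg, zero_smul]
    rintro ⟨h1, h2⟩
    obtain ⟨⟨R, hR⟩, n⟩ := v
    obtain ⟨⟨S, hS⟩, m⟩ := w
    obtain rfl : R = S := h1
    exact hw (by obtain rfl := Fin.ext h2; rfl)
  · simp

lemma hilbert_eq_sum_min [Infinite k] (Z : FatPointScheme k) {i : ℕ}
    (hi : ∑ R ∈ Z.proj₁, Z.maxMult₁ R ≤ i + 1) (j : ℕ) :
    Z.hilbert i j = ∑ R ∈ Z.proj₁, ∑ n ∈ Finset.range (Z.maxMult₁ R), min (j + 1) (Z.a R n) := by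
  classical
  obtain ⟨c, hc⟩ := exists_forall_rep_ne (Z.support.image Prod.fst)
  obtain ⟨d, hd⟩ := exists_forall_rep_ne (Z.support.image Prod.snd)
  have hc' : ∀ P ∈ Z.support, P.1.rep 1 - c * P.1.rep 0 ≠ 0 :=
    fun P hP => hc _ (Finset.mem_image_of_mem _ hP)
  have hd' : ∀ P ∈ Z.support, P.2.rep 1 - d * P.2.rep 0 ≠ 0 :=
    fun P hP => hd _ (Finset.mem_image_of_mem _ hP)
  rw [hilbert, hilbertFunction, ← ker_fiberMap hc' hd',
    ((Z.fiberMap c d i j).quotKerEquivOfSurjective (fiberMap_surjective hc' d hi j)).finrank_eq]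
  have (n : ℕ) : Module.Finite k (Polynomial.degreeLT k n) :=
    Module.Finite.equiv (Polynomial.degreeLTEquiv k n).symm
  rw [Module.finrank_pi_fintype]
  simp only [Polynomial.finrank_degreeLT, natDegree_fiberPoly]
  rw [Fintype.sum_sigma]
  simp only [Finset.sum_range]
  exact Finset.sum_coe_sort Z.proj₁
    fun R => ∑ n : Fin (Z.maxMult₁ R), min (j + 1) (Z.a R n)

end FatPointScheme

/-- An entry `c` is counted once for each `h` with `1 ≤ h ≤ min m c`. -/
lemma Multiset.sum_card_filter_le (s : Multiset ℕ) (m : ℕ) :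
    ∑ h ∈ Finset.Icc 1 m, (s.filter fun c => h ≤ c).card = (s.map (min m)).sum := by
  induction s using Multiset.induction_on with
  | empty => simp
  | cons c s ih =>
    simp only [Multiset.filter_cons, Multiset.card_add, Finset.sum_add_distrib, ih,
      Multiset.map_cons, Multiset.sum_cons]
    congr 1
    have h (h : ℕ) : (if h ≤ c then ({c} : Multiset ℕ) else 0).card = if h ≤ c then 1 else 0 := by
      split_ifs <;> simp
    simp only [h, ← Finset.card_filter]
    rw [show (Finset.Icc 1 m).filter (· ≤ c) = Finset.Icc 1 (min m c) by ext; simp; omega]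
    simp

/-! ### The two formulas, related by exchanging the factors -/

namespace FatPointScheme

open FatPoints

variable {k : Type*} [Field k]

lemma hilbert_eq_alpha [Infinite k] (Z : FatPointScheme k) {i : ℕ}
    (hi : (∑ R ∈ Z.proj₁, (Z.maxMult₁ R : ℤ)) - 1 ≤ (i : ℤ)) (j : ℕ) :
    Z.hilbert i j = ∑ h ∈ Finset.Icc 1 (j + 1), (Z.alpha.filter fun c => h ≤ c).card := by
  rw [Multiset.sum_card_filter_le, hilbert_eq_sum_min Z (by zify; linarith), alpha]
  -- The sum of the minima is additive in the multiset, hence passes through the sum over `R`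
  -- defining `alpha`.
  let φ : Multiset ℕ →+ ℕ :=
    Multiset.sumAddMonoidHom.comp (Multiset.mapAddMonoidHom (min (j + 1)))
  change _ = φ _
  rw [map_sum]
  refine Finset.sum_congr rfl fun R _ => ?_
  exact congrArg Multiset.sum (Multiset.map_map (min (j + 1)) (Z.a R) (Multiset.range _)).symm

/-- The image of `Z` under the exchange of the two factors of `ℙ¹ × ℙ¹`. -/
def swap (Z : FatPointScheme k) : FatPointScheme k :=
  Finsupp.equivMapDomain (Equiv.prodComm _ _) Z

lemma swap_apply (Z : FatPointScheme k) (P : P1 k × P1 k) : Z.swap P = Z P.swap := rfl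

lemma mem_support_swap {Z : FatPointScheme k} {P : P1 k × P1 k} :
    P ∈ Z.swap.support ↔ P.swap ∈ Z.support := by
  simp [swap_apply]

lemma proj₁_swap (Z : FatPointScheme k) : Z.swap.proj₁ = Z.proj₂ := by
  classical
  ext R
  simp only [proj₁, proj₂, Finset.mem_image, mem_support_swap]
  exact ⟨fun ⟨P, hP, h⟩ => ⟨P.swap, hP, h⟩, fun ⟨P, hP, h⟩ => ⟨P.swap, by simpa using hP, h⟩⟩

lemma fiber₁_swap (Z : FatPointScheme k) (Q : P1 k) :
    Z.swap.fiber₁ Q = (Z.fiber₂ Q).map (Equiv.prodComm _ _).toEmbedding := by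
  classical
  ext P
  rw [Finset.mem_map_equiv]
  simp [fiber₁, fiber₂, swap_apply]

lemma maxMult₁_swap (Z : FatPointScheme k) (Q : P1 k) : Z.swap.maxMult₁ Q = Z.maxMult₂ Q := by
  rw [maxMult₁, fiber₁_swap, Finset.sup_map]; rfl

lemma a_swap (Z : FatPointScheme k) (Q : P1 k) (n : ℕ) : Z.swap.a Q n = Z.b Q n := by
  rw [a, fiber₁_swap, Finset.sum_map]; rfl

lemma alpha_swap (Z : FatPointScheme k) : Z.swap.alpha = Z.beta := by
  simp only [alpha, beta, proj₁_swap, maxMult₁_swap]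
  simp only [funext (a_swap Z _)]

/-- The exchange of the two pairs of variables. -/
def swapVars (k : Type*) [Field k] : CoordRing k ≃ₐ[k] CoordRing k :=
  renameEquiv k (Equiv.sumComm _ _)

lemma map_swapVars_pointIdeal (P : P1 k × P1 k) :
    (pointIdeal P).map (swapVars k).toRingEquiv = pointIdeal P.swap := by
  rw [pointIdeal, vectorIdeal, Ideal.map_span, Set.image_pair, Set.pair_comm]
  simp [swapVars, pointIdeal, vectorIdeal]

lemma swapVars_mem_ideal_iff {Z : FatPointScheme k} {f : CoordRing k} :
    swapVars k f ∈ Z.swap.ideal ↔ f ∈ Z.ideal := by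
  have h (P : P1 k × P1 k) (m : ℕ) : swapVars k f ∈ pointIdeal P.swap ^ m ↔ f ∈ pointIdeal P ^ m := by
    rw [← map_swapVars_pointIdeal, ← Ideal.map_pow]
    exact Ideal.apply_mem_of_equiv_iff (f := (swapVars k).toRingEquiv)
  simp only [mem_ideal_iff, mem_support_swap, swap_apply]
  exact ⟨fun H P hP => (h P _).1 (H P.swap (by simpa using hP)),
    fun H P hP => (h P.swap _).2 (H P.swap hP)⟩

lemma swapVars_mem_bihomogeneous {i j : ℕ} {f : CoordRing k} (hf : f ∈ bihomogeneous k i j) :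
    swapVars k f ∈ bihomogeneous k j i := by
  intro e he
  obtain ⟨u, rfl, hu⟩ := coeff_rename_ne_zero _ _ _ he
  have := hf hu
  rw [finsupp_bidegree, Prod.mk.injEq] at this
  rw [← Finsupp.equivMapDomain_eq_mapDomain, finsupp_bidegree, Prod.mk.injEq]
  exact this.symm

/-- The exchange of variables maps `R_{i,j}` isomorphically to `R_{j,i}` and carries one ideal to
the other. -/
lemma hilbert_swap (Z : FatPointScheme k) (i j : ℕ) : Z.swap.hilbert j i = Z.hilbert i j := by
  have hinv (f : CoordRing k) : swapVars k (swapVars k f) = f := by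
    simp [swapVars, rename_rename]
  let e : bihomogeneous k i j ≃ₗ[k] bihomogeneous k j i :=
    (swapVars k).toLinearEquiv.ofSubmodules _ _ (le_antisymm
      (Submodule.map_le_iff_le_comap.2 fun _ hf => swapVars_mem_bihomogeneous hf)
      fun f hf => ⟨swapVars k f, swapVars_mem_bihomogeneous hf, hinv f⟩)
  have he (f : bihomogeneous k i j) : (e f : CoordRing k) = swapVars k f := rfl
  refine (LinearEquiv.finrank_eq (Submodule.Quotient.equiv _ _ e ?_)).symm
  ext g
  obtain ⟨f, rfl⟩ := e.surjective g
  rw [Submodule.mem_map_equiv, LinearEquiv.symm_apply_apply]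
  exact swapVars_mem_ideal_iff.symm

lemma hilbert_eq_beta [Infinite k] (Z : FatPointScheme k) {j : ℕ}
    (hj : (∑ Q ∈ Z.proj₂, (Z.maxMult₂ Q : ℤ)) - 1 ≤ (j : ℤ)) (i : ℕ) :
    Z.hilbert i j = ∑ h ∈ Finset.Icc 1 (i + 1), (Z.beta.filter fun c => h ≤ c).card := by
  rw [← hilbert_swap, ← alpha_swap]
  refine hilbert_eq_alpha _ ?_ _
  simpa only [proj₁_swap, maxMult₁_swap] using hj

end FatPointScheme

/-- A sum over the image of `π`, whose terms depend only on the multiset of values of `f` on the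
fibres of `π`, is invariant under bijections compatible with `f` and with the fibres. -/
lemma Finset.sum_image_fiber_eq_of_equiv {α α' β β' γ M : Type*} [AddCommMonoid M]
    [DecidableEq β] [DecidableEq β'] {s : Finset α} {s' : Finset α'} (e : s ≃ s') {f : α → γ}
    {f' : α' → γ} {π : α → β} {π' : α' → β'} (hf : ∀ x, f' (e x) = f x)
    (hπ : ∀ x y, π' (e x) = π' (e y) ↔ π x = π y) (F : Multiset γ → M) :
    ∑ b ∈ s'.image π', F ((s'.filter fun x => π' x = b).val.map f') =
      ∑ b ∈ s.image π, F ((s.filter fun x => π x = b).val.map f) := by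
  -- A chosen point of each fibre transports it: `b` goes to the fibre through `e (x b)`, and `hπ`
  -- removes the dependence on the choice.
  choose x hx hxπ using fun b (hb : b ∈ s.image π) => Finset.mem_image.1 hb
  have hfib (y : s) : (s'.filter fun z => π' z = π' (e y)).val.map f' =
      (s.filter fun z => π z = π y).val.map f := by
    refine Multiset.map_eq_map_of_bij_of_nodup _ _ (Finset.nodup _) (Finset.nodup _)
      (fun z hz => (e.symm ⟨z, (Finset.mem_filter.1 hz).1⟩ : α)) ?_ ?_ ?_ ?_
    · intro z hz
      have hz := Finset.mem_filter.1 hz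
      refine Finset.mem_filter.2 ⟨Subtype.coe_prop _, (hπ _ _).1 ?_⟩
      rw [e.apply_symm_apply]
      exact hz.2
    · intro z hz w hw h
      simpa using h
    · intro z hz
      have hz := Finset.mem_filter.1 hz
      exact ⟨e ⟨z, hz.1⟩, Finset.mem_filter.2 ⟨Subtype.coe_prop _, (hπ _ _).2 hz.2⟩, by simp⟩
    · intro z hz
      rw [← hf, e.apply_symm_apply]
  symm
  refine Finset.sum_bij (fun b hb => π' (e ⟨x b hb, hx b hb⟩)) ?_ ?_ ?_ ?_
  · intro b hb
    exact Finset.mem_image_of_mem _ (Subtype.coe_prop _)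
  · intro b hb c hc h
    rw [← hxπ b hb, ← hxπ c hc]
    exact (hπ _ _).1 h
  · intro b' hb'
    obtain ⟨y', hy', rfl⟩ := Finset.mem_image.1 hb'
    obtain ⟨y, hy⟩ := e.surjective ⟨y', hy'⟩
    have hb : π y ∈ s.image π := Finset.mem_image_of_mem _ y.2
    refine ⟨π y, hb, ?_⟩
    rw [(hπ ⟨x (π y) hb, hx _ hb⟩ y).2 (hxπ _ hb), hy]
  · intro b hb
    rw [hfib]
    simp only [hxπ b hb]

/-! ### Invariance under the combinatorial type -/

namespace FatPointScheme

open FatPoints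

variable {k : Type*} [Field k]

open scoped Classical in
lemma SameType.sum_proj₁_eq {M : Type*} [AddCommMonoid M] {Z Z' : FatPointScheme k}
    (h : Z.SameType Z') (F : Multiset ℕ → M) :
    ∑ R ∈ Z'.proj₁, F ((Z'.fiber₁ R).val.map Z') = ∑ R ∈ Z.proj₁, F ((Z.fiber₁ R).val.map Z) := by
  obtain ⟨e, hm, h1, -⟩ := h
  exact Finset.sum_image_fiber_eq_of_equiv e hm h1 F

open scoped Classical in
lemma SameType.sum_proj₂_eq {M : Type*} [AddCommMonoid M] {Z Z' : FatPointScheme k}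
    (h : Z.SameType Z') (F : Multiset ℕ → M) :
    ∑ Q ∈ Z'.proj₂, F ((Z'.fiber₂ Q).val.map Z') = ∑ Q ∈ Z.proj₂, F ((Z.fiber₂ Q).val.map Z) := by
  obtain ⟨e, hm, -, h2⟩ := h
  exact Finset.sum_image_fiber_eq_of_equiv e hm h2 F

/-- This and the next three lemmas express the invariants through the multiset of multiplicities on
a fibre, the form needed by `sum_proj₁_eq` and `sum_proj₂_eq`. -/
lemma maxMult₁_eq (Z : FatPointScheme k) (R : P1 k) :
    Z.maxMult₁ R = ((Z.fiber₁ R).val.map Z).sup := rfl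

lemma maxMult₂_eq (Z : FatPointScheme k) (Q : P1 k) :
    Z.maxMult₂ Q = ((Z.fiber₂ Q).val.map Z).sup := rfl

lemma a_eq (Z : FatPointScheme k) (R : P1 k) :
    Z.a R = fun n => (((Z.fiber₁ R).val.map Z).map (· - n)).sum := by
  ext n
  rw [Multiset.map_map]
  rfl

lemma b_eq (Z : FatPointScheme k) (Q : P1 k) :
    Z.b Q = fun n => (((Z.fiber₂ Q).val.map Z).map (· - n)).sum := by
  ext n
  rw [Multiset.map_map]
  rfl

lemma SameType.alpha_eq {Z Z' : FatPointScheme k} (h : Z.SameType Z') : Z'.alpha = Z.alpha := by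
  simp only [alpha, maxMult₁_eq, a_eq]
  exact h.sum_proj₁_eq fun s => (Multiset.range s.sup).map fun n => (s.map (· - n)).sum

lemma SameType.beta_eq {Z Z' : FatPointScheme k} (h : Z.SameType Z') : Z'.beta = Z.beta := by
  simp only [beta, maxMult₂_eq, b_eq]
  exact h.sum_proj₂_eq fun s => (Multiset.range s.sup).map fun n => (s.map (· - n)).sum

lemma SameType.sum_maxMult₁_eq {Z Z' : FatPointScheme k} (h : Z.SameType Z') :
    ∑ R ∈ Z'.proj₁, (Z'.maxMult₁ R : ℤ) = ∑ R ∈ Z.proj₁, (Z.maxMult₁ R : ℤ) :=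
  h.sum_proj₁_eq fun s => (s.sup : ℤ)

lemma SameType.sum_maxMult₂_eq {Z Z' : FatPointScheme k} (h : Z.SameType Z') :
    ∑ Q ∈ Z'.proj₂, (Z'.maxMult₂ Q : ℤ) = ∑ Q ∈ Z.proj₂, (Z.maxMult₂ Q : ℤ) :=
  h.sum_proj₂_eq fun s => (s.sup : ℤ)

end FatPointScheme

end

theorem theorem3p2 {k : Type*} [Field k] [IsAlgClosed k] (Z : FatPointScheme k) :
    (∀ i j : ℕ, (∑ R ∈ Z.proj₁, (Z.maxMult₁ R : ℤ)) - 1 ≤ (i : ℤ) →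
      Z.hilbert i j = ∑ h ∈ Finset.Icc 1 (j + 1), (Z.alpha.filter fun c => h ≤ c).card) ∧
    (∀ i j : ℕ, (∑ Q ∈ Z.proj₂, (Z.maxMult₂ Q : ℤ)) - 1 ≤ (j : ℤ) →
      Z.hilbert i j = ∑ h ∈ Finset.Icc 1 (i + 1), (Z.beta.filter fun c => h ≤ c).card) ∧
    (∀ Z' : FatPointScheme k, Z.SameType Z' →
      (∀ i j : ℕ, (∑ R ∈ Z.proj₁, (Z.maxMult₁ R : ℤ)) - 1 ≤ (i : ℤ) →
        Z'.hilbert i j = Z.hilbert i j) ∧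
      (∀ i j : ℕ, (∑ Q ∈ Z.proj₂, (Z.maxMult₂ Q : ℤ)) - 1 ≤ (j : ℤ) →
        Z'.hilbert i j = Z.hilbert i j)) := by
  refine ⟨fun i j hi => Z.hilbert_eq_alpha hi j, fun i j hj => Z.hilbert_eq_beta hj i,
    fun Z' h => ⟨fun i j hi => ?_, fun i j hj => ?_⟩⟩
  -- The bound is itself a type invariant, so the formula applies to `Z'` in the same range.
  · rw [Z.hilbert_eq_alpha hi, Z'.hilbert_eq_alpha (h.sum_maxMult₁_eq ▸ hi), h.alpha_eq]
  · rw [Z.hilbert_eq_beta hj, Z'.hilbert_eq_beta (h.sum_maxMult₂_eq ▸ hj), h.beta_eq]
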